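/- Let $G=(V,E)$ be a finite connected simple graph of girth at least $6$ (no cycles of length $3,4,5$; trees are allowed). For a positive weight $\omega\in\mathbb{R}_{>0}^{E}$ put $m(x)=\sum_{y\sim x}\omega_{xy}$, let $m_x^\alpha$ be the probability measure on $V$ with mass $\alpha$ at $x$ and mass $(1-\alpha)\,\omega_{xy}/m(x)$ at each neighbour $y$ of $x$, let $W$ be the Wasserstein distance with respect to the combinatorial graph distance $d$, and for $e=xy\in E$ let $$\kappa_e(\omega)=\lim_{\alpha\to1^-}\frac{1}{1-\alpha}\Bigl(1-\frac{W(m_x^\alpha,m_y^\alpha)}{d(x,y)}\Bigr)$$ be the Lin–Lu–Yau curvature of $e$. Let $\kappa^*\in\mathbb{R}^{E}$ satisfy $\sum_{e\in E}\kappa^*_e=2(|V|-|E|)$, and let $\omega(t)$, $t\ge0$, be a positive solution, continuous on $[0,\infty)$, of the prescribed-curvature flow $$\frac{d}{dt}\omega_e(t)=-\bigl(\kappa_e(\omega(t))-\kappa^*_e\bigr)\,\omega_e(t)\quad(t>0,\ e\in E),\qquad \omega(0)=\omega_0 .$$ Suppose that $\omega(t)$ converges in $\mathbb{R}^{E}$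 to some $\omega_\infty$ as $t\to\infty$. Then $\kappa^*$ is attainable, that is, there is a positive weight $\omega^*$ with $\kappa_e(\omega^*)=\kappa^*_e$ for all $e\in E$. Moreover, the limit $\omega_\infty$ is itself such a weight: it is positive and $\kappa_e(\omega_\infty)=\kappa^*_e$ for all $e\in E$. It is the unique such weight up to scaling: a positive weight $\omega$ satisfies $\kappa_e(\omega)=\kappa^*_e$ for all $e\in E$ if and only if $\omega=c\,\omega_\infty$ for some $c>0$. -/

import Mathlib

open Filter Topology

namespace PrescribedFlow

noncomputable section

/-- The edge weight `ω_{xy}` as a function of two vertices, extended by `0` to non-adjacent pairs.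
Weights are vectors indexed by the edges of `G`. -/
def edgeWeight {V : Type*} (G : SimpleGraph V) [DecidableRel G.Adj]
    (w : G.edgeSet → ℝ) (x y : V) : ℝ :=
  if h : G.Adj x y then w ⟨s(x, y), h⟩ else 0

/-- `m(x) = ∑_{y ∼ x} ω_{xy}`. -/
def vertexMass {V : Type*} [Fintype V] (G : SimpleGraph V) [DecidableRel G.Adj]
    (w : G.edgeSet → ℝ) (x : V) : ℝ :=
  ∑ y, edgeWeight G w x y

/-- The lazy random walk measure `m_x^α`: mass `α` at `x`, and mass
`(1 - α) ω_{xy} / m(x)` at each neighbour `y` of `x`. -/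
def lazyMeasure {V : Type*} [Fintype V] [DecidableEq V] (G : SimpleGraph V) [DecidableRel G.Adj]
    (w : G.edgeSet → ℝ) (α : ℝ) (x y : V) : ℝ :=
  if y = x then α else (1 - α) * (edgeWeight G w x y / vertexMass G w x)

/-- `A` is a transport plan from `μ` to `ν`. -/
structure IsTransportPlan {V : Type*} [Fintype V] (μ ν : V → ℝ) (A : V → V → ℝ) : Prop where
  mem_unit : ∀ u v, A u v ∈ Set.Icc (0 : ℝ) 1
  source : ∀ u, ∑ v, A u v = μ u
  target : ∀ v, ∑ u, A u v = ν v

/-- The Wasserstein distance with respect to the (unweighted) graph distance. -/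
def wasserstein {V : Type*} [Fintype V] (G : SimpleGraph V) (μ ν : V → ℝ) : ℝ :=
  sInf {c : ℝ | ∃ A : V → V → ℝ, IsTransportPlan μ ν A ∧
    c = ∑ u, ∑ v, (G.dist u v : ℝ) * A u v}

/-- The quotient `(1 / (1 - α)) (1 - W(m_x^α, m_y^α) / d(x, y))`. -/
def curvatureQuotient {V : Type*} [Fintype V] [DecidableEq V] (G : SimpleGraph V)
    [DecidableRel G.Adj] (w : G.edgeSet → ℝ) (x y : V) (α : ℝ) : ℝ :=
  1 / (1 - α) *
    (1 - wasserstein G (lazyMeasure G w α x) (lazyMeasure G w α y) / (G.dist x y : ℝ))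

/-- The limit defining the Lin-Lu-Yau curvature of `x, y` exists and is equal to `k`. -/
def HasCurvature {V : Type*} [Fintype V] [DecidableEq V] (G : SimpleGraph V)
    [DecidableRel G.Adj] (w : G.edgeSet → ℝ) (x y : V) (k : ℝ) : Prop :=
  Tendsto (curvatureQuotient G w x y) (𝓝[<] 1) (𝓝 k)

/-- The Lin-Lu-Yau curvature `κ(x, y)`, the limit of the quotient as `α → 1⁻`. -/
def curvature {V : Type*} [Fintype V] [DecidableEq V] (G : SimpleGraph V)
    [DecidableRel G.Adj] (w : G.edgeSet → ℝ) (x y : V) : ℝ :=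
  limUnder (𝓝[<] (1 : ℝ)) (curvatureQuotient G w x y)

theorem HasCurvature.curvature_eq {V : Type*} [Fintype V] [DecidableEq V] {G : SimpleGraph V}
    [DecidableRel G.Adj] {w : G.edgeSet → ℝ} {x y : V} {k : ℝ} (h : HasCurvature G w x y k) :
    curvature G w x y = k :=
  Tendsto.limUnder_eq h

/-- `w` is a positive weight whose Lin-Lu-Yau curvature on every edge is the one prescribed by
`κ`. -/
structure IsWeightOf {V : Type*} [Fintype V] [DecidableEq V] (G : SimpleGraph V)
    [DecidableRel G.Adj] (κ : G.edgeSet → ℝ) (w : G.edgeSet → ℝ) : Prop where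
  pos : ∀ e, 0 < w e
  curvature_eq : ∀ (x y : V) (h : G.Adj x y), HasCurvature G w x y (κ ⟨s(x, y), h⟩)

/-- `κ` is realized by some positive weight. -/
def Attainable {V : Type*} [Fintype V] [DecidableEq V] (G : SimpleGraph V)
    [DecidableRel G.Adj] (κ : G.edgeSet → ℝ) : Prop :=
  ∃ w : G.edgeSet → ℝ, IsWeightOf G κ w

/-- `ω` is a (positive) solution on `[0, ∞)` of the flow
`dω_e/dt = -(κ_e(ω) - κ*_e) ω_e` for `t > 0`, with initial value `ω₀`. -/
structure IsFlowSolution {V : Type*} [Fintype V] [DecidableEq V] (G : SimpleGraph V)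
    [DecidableRel G.Adj] (κ : G.edgeSet → ℝ) (ω₀ : G.edgeSet → ℝ)
    (ω : ℝ → G.edgeSet → ℝ) : Prop where
  initial : ω 0 = ω₀
  pos : ∀ t, 0 ≤ t → ∀ e, 0 < ω t e
  continuousOn : ContinuousOn ω (Set.Ici 0)
  flow : ∀ t, 0 < t → ∀ (x y : V) (h : G.Adj x y),
    HasDerivAt (fun s => ω s ⟨s(x, y), h⟩)
      (-(curvature G (ω t) x y - κ ⟨s(x, y), h⟩) * ω t ⟨s(x, y), h⟩) t

end

end PrescribedFlow

namespace SimpleGraph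

variable {V : Type*} {G : SimpleGraph V}

theorem not_adj_of_six_le_egirth (hg : 6 ≤ G.egirth) {a b c : V} (hab : G.Adj a b)
    (hbc : G.Adj b c) : ¬ G.Adj c a := by
  intro hca
  have h := (le_egirth.1 hg) a (.cons hab (.cons hbc (.cons hca .nil))) (by
    rw [Walk.cons_isCycle_iff]
    have := hab.ne; have := hbc.ne; have := hca.ne
    simp [Walk.isPath_def]
    grind)
  simp at h
  norm_cast at h

theorem not_adj_of_six_le_egirth_of_path_four (hg : 6 ≤ G.egirth) {a b c d : V}
    (hab : G.Adj a b) (hbc : G.Adj b c) (hcd : G.Adj c d) (hac : a ≠ c) (hbd : b ≠ d) :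
    ¬ G.Adj d a := by
  intro hda
  have h := (le_egirth.1 hg) a (.cons hab (.cons hbc (.cons hcd (.cons hda .nil)))) (by
    rw [Walk.cons_isCycle_iff]
    have := hab.ne; have := hbc.ne; have := hcd.ne; have := hda.ne
    simp [Walk.isPath_def]
    grind)
  simp at h
  norm_cast at h

theorem not_adj_of_six_le_egirth_of_path_five (hg : 6 ≤ G.egirth) {a b c d e : V}
    (hab : G.Adj a b) (hbc : G.Adj b c) (hcd : G.Adj c d) (hde : G.Adj d e)
    (hac : a ≠ c) (hbd : b ≠ d) (hce : c ≠ e) :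
    ¬ G.Adj e a := by
  intro hea
  have had : a ≠ d := fun h => not_adj_of_six_le_egirth hg hab hbc (h ▸ hcd)
  have hbe : b ≠ e := fun h => not_adj_of_six_le_egirth hg hbc hcd (h ▸ hde)
  have h := (le_egirth.1 hg) a
    (.cons hab (.cons hbc (.cons hcd (.cons hde (.cons hea .nil))))) (by
    rw [Walk.cons_isCycle_iff]
    have := hab.ne; have := hbc.ne; have := hcd.ne; have := hde.ne; have := hea.ne
    simp [Walk.isPath_def]
    grind)
  simp at h
  norm_cast at h

theorem Connected.one_le_dist (hc : G.Connected) {u v : V} (h : u ≠ v) : 1 ≤ G.dist u v :=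
  hc.pos_dist_of_ne h

theorem Connected.two_le_dist (hc : G.Connected) {u v : V} (h : u ≠ v) (h' : ¬ G.Adj u v) :
    2 ≤ G.dist u v := by
  have h1 := hc.one_le_dist h
  have h2 : G.dist u v ≠ 1 := fun e => h' (dist_eq_one_iff_adj.1 e)
  omega

theorem Connected.three_le_dist_of_six_le_egirth (hc : G.Connected) (hg : 6 ≤ G.egirth)
    {x y z t : V} (hxy : G.Adj x y) (hxz : G.Adj x z) (hyt : G.Adj y t) (hz : z ≠ y)
    (ht : t ≠ x) : 3 ≤ G.dist z t := by
  have hzt : z ≠ t := by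
    rintro rfl
    exact not_adj_of_six_le_egirth hg hxy hyt hxz.symm
  have h2 := hc.two_le_dist hzt fun h =>
    not_adj_of_six_le_egirth_of_path_four hg hxz.symm hxy hyt hz ht.symm h.symm
  by_contra hlt
  have h : G.dist z t = 2 := by omega
  obtain ⟨p, hp⟩ := hc.exists_walk_length_eq_dist z t
  rw [h] at hp
  match p, hp with
  | .cons (v := c) hzc (.cons hct .nil), _ =>
    refine not_adj_of_six_le_egirth_of_path_five hg hxz.symm hxy hyt hct.symm hz ht.symm ?_ hzc.symm
    rintro rfl
    exact not_adj_of_six_le_egirth hg hxy hzc.symm hxz.symm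

end SimpleGraph

namespace PrescribedFlow

variable {V : Type*} {G : SimpleGraph V} [DecidableRel G.Adj] {w : G.edgeSet → ℝ}

theorem edgeWeight_of_adj {x y : V} (h : G.Adj x y) : edgeWeight G w x y = w ⟨s(x, y), h⟩ :=
  dif_pos h

theorem edgeWeight_of_not_adj {x y : V} (h : ¬ G.Adj x y) : edgeWeight G w x y = 0 :=
  dif_neg h

theorem edgeWeight_comm (x y : V) : edgeWeight G w x y = edgeWeight G w y x := by
  by_cases h : G.Adj x y
  · rw [edgeWeight_of_adj h, edgeWeight_of_adj h.symm]
    congr 2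
    exact Sym2.eq_swap
  · rw [edgeWeight_of_not_adj h, edgeWeight_of_not_adj fun h' => h h'.symm]

theorem edgeWeight_nonneg (hw : ∀ e, 0 < w e) (x y : V) : 0 ≤ edgeWeight G w x y := by
  unfold edgeWeight
  split_ifs
  exacts [(hw _).le, le_rfl]

variable [Fintype V]

theorem edgeWeight_le_vertexMass (hw : ∀ e, 0 < w e) (x y : V) :
    edgeWeight G w x y ≤ vertexMass G w x :=
  Finset.single_le_sum (fun z _ => edgeWeight_nonneg hw x z) (Finset.mem_univ y)

theorem vertexMass_pos (hw : ∀ e, 0 < w e) {x y : V} (h : G.Adj x y) :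
    0 < vertexMass G w x :=
  (by rw [edgeWeight_of_adj h]; exact hw _ : 0 < edgeWeight G w x y).trans_le
    (edgeWeight_le_vertexMass hw x y)

variable [DecidableEq V]

theorem sum_mul_lazyMeasure (α : ℝ) (x : V) (f : V → ℝ) :
    ∑ u, f u * lazyMeasure G w α x u =
      α * f x + (1 - α) * ((∑ u, f u * edgeWeight G w x u) / vertexMass G w x) := by
  have h : ∀ u, f u * lazyMeasure G w α x u = (if u = x then α * f u else 0) +
      (1 - α) * (f u * edgeWeight G w x u / vertexMass G w x) := by
    intro u
    unfold lazyMeasure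
    split_ifs with hu
    · subst hu
      rw [edgeWeight_of_not_adj (G.irrefl)]
      ring
    · ring
  simp_rw [h, Finset.sum_add_distrib, ← Finset.mul_sum, ← Finset.sum_div]
  simp

theorem sum_lazyMeasure (hw : ∀ e, 0 < w e) (α : ℝ) {x y : V} (h : G.Adj x y) :
    ∑ u, lazyMeasure G w α x u = 1 := by
  have := sum_mul_lazyMeasure (w := w) α x fun _ => 1
  simp only [one_mul] at this
  rw [this, ← vertexMass, div_self (vertexMass_pos hw h).ne']
  ring

theorem lazyMeasure_nonneg (hw : ∀ e, 0 < w e) {α : ℝ} (h0 : 0 ≤ α) (h1 : α ≤ 1) (x u : V) :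
    0 ≤ lazyMeasure G w α x u := by
  unfold lazyMeasure
  split_ifs
  · exact h0
  · exact mul_nonneg (by linarith) (div_nonneg (edgeWeight_nonneg hw _ _)
      (Finset.sum_nonneg fun z _ => edgeWeight_nonneg hw x z))

theorem lazyMeasure_eq_zero {α : ℝ} {x u : V} (hu : u ≠ x) (h : ¬ G.Adj x u) :
    lazyMeasure G w α x u = 0 := by
  rw [lazyMeasure, if_neg hu, edgeWeight_of_not_adj h]
  simp

omit [DecidableEq V] in
theorem IsTransportPlan.eq_zero_of_source {μ ν : V → ℝ} {A : V → V → ℝ}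
    (hA : IsTransportPlan μ ν A) {u : V} (hu : μ u = 0) (v : V) : A u v = 0 := by
  have := hA.source u
  rw [hu, Finset.sum_eq_zero_iff_of_nonneg fun v _ => (hA.mem_unit u v).1] at this
  exact this v (Finset.mem_univ v)

omit [DecidableEq V] in
theorem IsTransportPlan.eq_zero_of_target {μ ν : V → ℝ} {A : V → V → ℝ}
    (hA : IsTransportPlan μ ν A) {v : V} (hv : ν v = 0) (u : V) : A u v = 0 := by
  have := hA.target v
  rw [hv, Finset.sum_eq_zero_iff_of_nonneg fun u _ => (hA.mem_unit u v).1] at this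
  exact this u (Finset.mem_univ u)

omit [DecidableEq V] [DecidableRel G.Adj] in
/-- Weak Kantorovich duality, with the potential tested on the supports only. -/
theorem IsTransportPlan.le_cost {μ ν : V → ℝ} {A : V → V → ℝ} (hA : IsTransportPlan μ ν A)
    {f : V → ℝ} (hf : ∀ u v, μ u ≠ 0 → ν v ≠ 0 → f u - f v ≤ G.dist u v) :
    ∑ u, f u * μ u - ∑ v, f v * ν v ≤ ∑ u, ∑ v, (G.dist u v : ℝ) * A u v := by
  have h1 : ∑ u, f u * μ u = ∑ u, ∑ v, f u * A u v := by
    simp_rw [← Finset.mul_sum, hA.source]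
  have h2 : ∑ v, f v * ν v = ∑ u, ∑ v, f v * A u v := by
    rw [Finset.sum_comm]
    simp_rw [← Finset.mul_sum, hA.target]
  rw [h1, h2, ← Finset.sum_sub_distrib]
  refine Finset.sum_le_sum fun u _ => ?_
  rw [← Finset.sum_sub_distrib]
  refine Finset.sum_le_sum fun v _ => ?_
  rw [← sub_mul]
  by_cases hu : μ u = 0
  · simp [hA.eq_zero_of_source hu]
  by_cases hv : ν v = 0
  · simp [hA.eq_zero_of_target hv]
  exact mul_le_mul_of_nonneg_right (hf u v hu hv) (hA.mem_unit u v).1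

/-- A `1`-Lipschitz potential for the transport from a neighbourhood of `x` to one of `y`. -/
def edgePotential (G : SimpleGraph V) [DecidableRel G.Adj] (x y u : V) : ℝ :=
  if u = x then 1 else if u = y then 0 else if G.Adj x u then 2 else if G.Adj y u then -1 else 0

omit [Fintype V] in
theorem edgePotential_sub_le_dist (hc : G.Connected) (hg : 6 ≤ G.egirth) {x y u v : V}
    (hxy : G.Adj x y) (hu : u = x ∨ G.Adj x u) (hv : v = y ∨ G.Adj y v) :
    edgePotential G x y u - edgePotential G x y v ≤ G.dist u v := by
  have hne := hxy.ne
  have hyx := hne.symm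
  have key : edgePotential G x y u - edgePotential G x y v ≤ 0 ∨
      (edgePotential G x y u - edgePotential G x y v ≤ 1 ∧ 1 ≤ G.dist u v) ∨
      (edgePotential G x y u - edgePotential G x y v ≤ 2 ∧ 2 ≤ G.dist u v) ∨
      (edgePotential G x y u - edgePotential G x y v ≤ 3 ∧ 3 ≤ G.dist u v) := by
    have hx : edgePotential G x y x = 1 := by simp [edgePotential]
    have hy : edgePotential G x y y = 0 := by simp [edgePotential, hyx]
    have hz : ∀ z, G.Adj x z → z ≠ y → edgePotential G x y z = 2 := by
      intro z h1 h2
      simp [edgePotential, h1.ne', h2, h1]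
    have ht : ∀ t, G.Adj y t → t ≠ x → edgePotential G x y t = -1 := by
      intro t h1 h2
      have : ¬ G.Adj x t := fun h => G.not_adj_of_six_le_egirth hg hxy h1 h.symm
      simp [edgePotential, h2, h1.ne', h1, this]
    by_cases hux : u = x
    · subst hux
      by_cases hvy : v = y
      · subst hvy
        right; left
        exact ⟨by rw [hx, hy]; norm_num, hc.one_le_dist hne⟩
      have hv := hv.resolve_left hvy
      by_cases hvx : v = u
      · subst hvx
        left; simp
      right; right; left
      exact ⟨by rw [hx, ht v hv hvx]; norm_num, hc.two_le_dist (Ne.symm hvx) fun h =>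
        G.not_adj_of_six_le_egirth hg hxy hv h.symm⟩
    have hu := hu.resolve_left hux
    by_cases huy : u = y
    · subst huy
      by_cases hvy : v = u
      · subst hvy
        left; simp
      have hv := hv.resolve_left hvy
      by_cases hvx : v = x
      · subst hvx
        left; rw [hx, hy]; norm_num
      right; left
      exact ⟨by rw [hy, ht v hv hvx]; norm_num, hc.one_le_dist (Ne.symm hvy)⟩
    by_cases hvy : v = y
    · subst hvy
      right; right; left
      exact ⟨by rw [hy, hz u hu huy]; norm_num, hc.two_le_dist huy fun h =>
        G.not_adj_of_six_le_egirth hg hxy h.symm hu.symm⟩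
    have hv := hv.resolve_left hvy
    by_cases hvx : v = x
    · subst hvx
      right; left
      exact ⟨by rw [hx, hz u hu huy]; norm_num, hc.one_le_dist hux⟩
    right; right; right
    exact ⟨by rw [hz u hu huy, ht v hv hvx]; norm_num,
      hc.three_le_dist_of_six_le_egirth hg hxy hu hv huy hvx⟩
  rcases key with h | ⟨h, h'⟩ | ⟨h, h'⟩ | ⟨h, h'⟩
  · exact h.trans (Nat.cast_nonneg _)
  all_goals exact h.trans (by exact_mod_cast h')

theorem sum_edgePotential_source {x y : V} :
    ∑ u, edgePotential G x y u * edgeWeight G w x u =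
      2 * vertexMass G w x - 2 * edgeWeight G w x y := by
  have h : ∀ u, edgePotential G x y u * edgeWeight G w x u =
      2 * edgeWeight G w x u - if u = y then 2 * edgeWeight G w x u else 0 := by
    intro u
    by_cases h : G.Adj x u
    · have := h.ne'
      by_cases huy : u = y <;> simp_all [edgePotential]
    · simp [edgeWeight_of_not_adj h]
  simp_rw [h, Finset.sum_sub_distrib, ← Finset.mul_sum]
  simp [vertexMass]

theorem sum_edgePotential_target (hg : 6 ≤ G.egirth) {x y : V} (hxy : G.Adj x y) :
    ∑ u, edgePotential G x y u * edgeWeight G w y u =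
      2 * edgeWeight G w x y - vertexMass G w y := by
  have h : ∀ u, edgePotential G x y u * edgeWeight G w y u =
      (if u = x then 2 * edgeWeight G w y u else 0) - edgeWeight G w y u := by
    intro u
    by_cases h : G.Adj y u
    · have h1 := h.ne'
      have : ¬ G.Adj x u := fun h' => G.not_adj_of_six_le_egirth hg hxy h h'.symm
      by_cases hux : u = x
      · simp [edgePotential, hux]; ring
      · simp [edgePotential, hux, h1, this, h]
    · simp [edgeWeight_of_not_adj h]
  simp_rw [h, Finset.sum_sub_distrib]
  simp [vertexMass, edgeWeight_comm]

/-- The transport plan that sends all mass through the edge `xy`. -/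
def edgePlan (x y : V) (μ ν : V → ℝ) (c : ℝ) (u v : V) : ℝ :=
  (if v = y then if u = x then c else μ u else 0) + if u = x then if v = y then 0 else ν v else 0

theorem isTransportPlan_edgePlan {x y : V} {μ ν : V → ℝ} {c : ℝ} (hc : 0 ≤ c)
    (hμ : ∀ u, 0 ≤ μ u) (hν : ∀ v, 0 ≤ ν v) (hμ1 : ∑ u, μ u = 1) (hν1 : ∑ v, ν v = 1)
    (hcμ : c = μ x + ν y - 1) : IsTransportPlan μ ν (edgePlan x y μ ν c) := by
  have hμle : ∀ u, μ u ≤ 1 := fun u =>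
    hμ1 ▸ Finset.single_le_sum (fun i _ => hμ i) (Finset.mem_univ u)
  have hνle : ∀ u, ν u ≤ 1 := fun u =>
    hν1 ▸ Finset.single_le_sum (fun i _ => hν i) (Finset.mem_univ u)
  have h1 : ∀ (ρ : V → ℝ) (a : V), ∑ u, (if u = a then 0 else ρ u) = ∑ u, ρ u - ρ a := by
    intro ρ a
    have h : ∀ u, (if u = a then 0 else ρ u) = ρ u - if u = a then ρ u else 0 := by
      intro u; split_ifs <;> simp
    simp [h, Finset.sum_sub_distrib]
  refine ⟨fun u v => ?_, fun u => ?_, fun v => ?_⟩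
  · have := hμle x; have := hνle y
    have := hμ u; have := hν v; have := hμle u; have := hνle v
    unfold edgePlan
    split_ifs <;> constructor <;> linarith
  · unfold edgePlan
    rw [Finset.sum_add_distrib]
    by_cases hu : u = x
    · simp only [hu, if_true, h1, hν1]
      simp; linarith
    · simp [hu]
  · unfold edgePlan
    rw [Finset.sum_add_distrib]
    by_cases hv : v = y
    · have : ∀ u, (if u = x then c else μ u) = (if u = x then c else 0) +
        if u = x then 0 else μ u := by intro u; split_ifs <;> simp
      simp only [hv, if_true, this, Finset.sum_add_distrib, h1, hμ1]
      simp; linarith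
    · simp [hv]

omit [DecidableRel G.Adj] in
theorem cost_edgePlan {x y : V} (hxy : G.Adj x y) {μ ν : V → ℝ} {c : ℝ} :
    ∑ u, ∑ v, (G.dist u v : ℝ) * edgePlan x y μ ν c u v =
      c + ∑ u, (if u = x then 0 else (G.dist u y : ℝ) * μ u) +
        ∑ v, if v = y then 0 else (G.dist x v : ℝ) * ν v := by
  have h : ∀ u v, (G.dist u v : ℝ) * edgePlan x y μ ν c u v =
      (if v = y then (if u = x then (G.dist u v : ℝ) * c else 0) +
        (if u = x then 0 else (G.dist u v : ℝ) * μ u) else 0) +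
      if u = x then if v = y then 0 else (G.dist u v : ℝ) * ν v else 0 := by
    intro u v
    unfold edgePlan
    split_ifs <;> simp
  have hd : G.dist x y = 1 := SimpleGraph.dist_eq_one_iff_adj.2 hxy
  simp_rw [h, Finset.sum_add_distrib]
  congr 1
  · simp [Finset.sum_add_distrib, hd]
  · rw [Finset.sum_comm]; simp

theorem dist_mul_lazyMeasure_le {α : ℝ} {x y u : V} (hw : ∀ e, 0 < w e) (hα : α ≤ 1)
    (hxy : G.Adj x y) :
    (if u = x then 0 else (G.dist u y : ℝ) * lazyMeasure G w α x u) ≤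
      (1 - α) * ((2 * edgeWeight G w x u - if u = y then 2 * edgeWeight G w x u else 0) /
        vertexMass G w x) := by
  have hα' : 0 ≤ 1 - α := by linarith
  have hm := vertexMass_pos hw hxy
  by_cases hux : u = x
  · subst hux
    simp [edgeWeight_of_not_adj (G.irrefl)]
  by_cases huy : u = y
  · simp [huy]
  by_cases h : G.Adj x u
  · have hd : G.dist u y ≤ 2 :=
      SimpleGraph.dist_le (.cons h.symm (.cons hxy .nil))
    have hd : (G.dist u y : ℝ) ≤ 2 := by exact_mod_cast hd
    have := edgeWeight_nonneg hw x u
    simp only [hux, huy, if_false, sub_zero, lazyMeasure]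
    calc _ ≤ 2 * ((1 - α) * (edgeWeight G w x u / vertexMass G w x)) := by gcongr
      _ = _ := by ring
  · simp [hux, huy, lazyMeasure, edgeWeight_of_not_adj h]

theorem sum_dist_mul_lazyMeasure_le {α : ℝ} {x y : V} (hw : ∀ e, 0 < w e) (hα : α ≤ 1)
    (hxy : G.Adj x y) :
    ∑ u, (if u = x then 0 else (G.dist u y : ℝ) * lazyMeasure G w α x u) ≤
      (1 - α) * (2 - 2 * edgeWeight G w x y / vertexMass G w x) := by
  have hm := vertexMass_pos hw hxy
  refine (Finset.sum_le_sum fun u _ => dist_mul_lazyMeasure_le hw hα hxy).trans_eq ?_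
  rw [← Finset.mul_sum, ← Finset.sum_div, Finset.sum_sub_distrib, ← Finset.mul_sum]
  simp only [Finset.sum_ite_eq', Finset.mem_univ, if_true]
  rw [← vertexMass, sub_div, mul_div_assoc, div_self hm.ne']
  ring

theorem wasserstein_lazyMeasure (hc : G.Connected) (hg : 6 ≤ G.egirth) (hw : ∀ e, 0 < w e)
    {x y : V} (hxy : G.Adj x y) {α : ℝ} (h0 : 1 / 2 ≤ α) (h1 : α ≤ 1) :
    wasserstein G (lazyMeasure G w α x) (lazyMeasure G w α y) =
      α + (1 - α) * (3 - 2 * edgeWeight G w x y * (1 / vertexMass G w x + 1 / vertexMass G w y)) := by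
  have hmx := vertexMass_pos hw hxy
  have hmy := vertexMass_pos hw hxy.symm
  have hx1 := sum_lazyMeasure hw α hxy
  have hy1 := sum_lazyMeasure hw α hxy.symm
  have hplan := isTransportPlan_edgePlan (x := x) (y := y) (c := 2 * α - 1) (by linarith)
    (lazyMeasure_nonneg hw (by linarith) h1 x) (lazyMeasure_nonneg hw (by linarith) h1 y) hx1 hy1
    (by simp [lazyMeasure]; ring)
  have hlow : ∀ c ∈ {c : ℝ | ∃ A : V → V → ℝ,
      IsTransportPlan (lazyMeasure G w α x) (lazyMeasure G w α y) A ∧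
        c = ∑ u, ∑ v, (G.dist u v : ℝ) * A u v},
      α + (1 - α) * (3 - 2 * edgeWeight G w x y *
        (1 / vertexMass G w x + 1 / vertexMass G w y)) ≤ c := by
    rintro c ⟨A, hA, rfl⟩
    have := hA.le_cost (f := edgePotential G x y) (fun u v hu hv =>
      edgePotential_sub_le_dist hc hg hxy
        (by by_contra! h; exact hu (lazyMeasure_eq_zero h.1 h.2))
        (by by_contra! h; exact hv (lazyMeasure_eq_zero h.1 h.2)))
    refine le_trans (le_of_eq ?_) this
    rw [sum_mul_lazyMeasure, sum_mul_lazyMeasure, sum_edgePotential_source,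
      sum_edgePotential_target hg hxy]
    simp only [edgePotential, if_true, hxy.ne', if_false]
    field_simp
    ring
  refine le_antisymm ?_ (le_csInf ⟨_, _, hplan, rfl⟩ hlow)
  refine (csInf_le ⟨_, hlow⟩ ⟨_, hplan, rfl⟩).trans ?_
  rw [cost_edgePlan hxy]
  have hX := sum_dist_mul_lazyMeasure_le (α := α) hw h1 hxy
  have hY := sum_dist_mul_lazyMeasure_le (α := α) hw h1 hxy.symm
  rw [edgeWeight_comm y x] at hY
  simp_rw [G.dist_comm (v := x)] at hY
  have : α + (1 - α) * (3 - 2 * edgeWeight G w x y *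
        (1 / vertexMass G w x + 1 / vertexMass G w y)) = 2 * α - 1 +
      (1 - α) * (2 - 2 * edgeWeight G w x y / vertexMass G w x) +
      (1 - α) * (2 - 2 * edgeWeight G w x y / vertexMass G w y) := by ring
  rw [this]
  gcongr

/-- The Lin-Lu-Yau curvature of an edge in a graph of girth at least `6`. -/
theorem hasCurvature_of_six_le_egirth (hc : G.Connected) (hg : 6 ≤ G.egirth)
    (hw : ∀ e, 0 < w e) {x y : V} (hxy : G.Adj x y) :
    HasCurvature G w x y
      (2 * edgeWeight G w x y * (1 / vertexMass G w x + 1 / vertexMass G w y) - 2) := by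
  refine tendsto_const_nhds.congr' ?_
  filter_upwards [Ioo_mem_nhdsLT (show (1 / 2 : ℝ) < 1 by norm_num)] with α hα
  have hd : G.dist x y = 1 := SimpleGraph.dist_eq_one_iff_adj.2 hxy
  have : 1 - α ≠ 0 := by linarith [hα.2]
  rw [curvatureQuotient, wasserstein_lazyMeasure hc hg hw hxy hα.1.le hα.2.le, hd, Nat.cast_one,
    div_one]
  field_simp
  ring

end PrescribedFlow

/-- A function whose derivative converges at infinity, and which itself converges, has derivative
converging to zero. -/
theorem eq_zero_of_tendsto_of_tendsto_deriv {f f' : ℝ → ℝ} {a L : ℝ}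
    (hf : ∀ t, 0 < t → HasDerivAt f (f' t) t) (hlim : Tendsto f atTop (𝓝 a))
    (hlim' : Tendsto f' atTop (𝓝 L)) : L = 0 := by
  have hmvt : ∀ n : ℕ, ∃ c : ℝ, (n : ℝ) + 1 < c ∧ f' c = f (n + 2) - f (n + 1) := by
    intro n
    have hn : (0 : ℝ) ≤ n := n.cast_nonneg
    obtain ⟨c, hc, h⟩ := exists_hasDerivAt_eq_slope f f' (show (n : ℝ) + 1 < n + 2 by linarith)
      (fun t ht => (hf t (by linarith [ht.1])).continuousAt.continuousWithinAt)
      (fun t ht => hf t (by linarith [ht.1]))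
    exact ⟨c, hc.1, by rw [h, show (n : ℝ) + 2 - (n + 1) = 1 by ring, div_one]⟩
  choose c hc hc' using hmvt
  have hn : Tendsto (fun n : ℕ => (n : ℝ)) atTop atTop := tendsto_natCast_atTop_atTop
  have hcT : Tendsto c atTop atTop :=
    tendsto_atTop_mono (fun n => by linarith [hc n]) hn
  have h1 := hlim'.comp hcT
  have h2 := (hlim.comp (tendsto_atTop_add_const_right _ 2 hn)).sub
    (hlim.comp (tendsto_atTop_add_const_right _ 1 hn))
  rw [sub_self] at h2
  exact tendsto_nhds_unique h1 (h2.congr fun n => (hc' n).symm)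

namespace PrescribedFlow

variable {V : Type*} [Fintype V] [DecidableEq V] {G : SimpleGraph V} [DecidableRel G.Adj]

/-- The curvature of an edge in terms of the weights, for girth at least `6`. -/
noncomputable def edgeCurvature (G : SimpleGraph V) [DecidableRel G.Adj] (w : G.edgeSet → ℝ)
    (e : G.edgeSet) : ℝ :=
  2 * (w e * ∑ v, if v ∈ (e : Sym2 V) then 1 / vertexMass G w v else 0) - 2

theorem edgeCurvature_mk (w : G.edgeSet → ℝ) {x y : V} (h : G.Adj x y) :
    edgeCurvature G w ⟨s(x, y), h⟩ =
      2 * edgeWeight G w x y * (1 / vertexMass G w x + 1 / vertexMass G w y) - 2 := by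
  have hs : ∀ v, (if v ∈ s(x, y) then 1 / vertexMass G w v else 0) =
      (if v = x then 1 / vertexMass G w v else 0) +
        if v = y then 1 / vertexMass G w v else 0 := by
    intro v
    have := h.ne
    simp only [Sym2.mem_iff]
    by_cases hx : v = x
    · have : v ≠ y := hx ▸ this
      simp [hx, h.ne]
    · simp [hx]
  rw [edgeCurvature, edgeWeight_of_adj h]
  simp only [hs, Finset.sum_add_distrib, Finset.sum_ite_eq', Finset.mem_univ, if_true]
  ring

theorem isWeightOf_iff (hc : G.Connected) (hg : 6 ≤ G.egirth) {κ w : G.edgeSet → ℝ} :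
    IsWeightOf G κ w ↔ (∀ e, 0 < w e) ∧ ∀ e, edgeCurvature G w e = κ e := by
  constructor
  · rintro ⟨hw, h⟩
    refine ⟨hw, ?_⟩
    rintro ⟨e, he⟩
    induction e using Sym2.ind with
    | _ x y =>
      rw [edgeCurvature_mk w he]
      exact tendsto_nhds_unique (hasCurvature_of_six_le_egirth hc hg hw he) (h x y he)
  · rintro ⟨hw, h⟩
    refine ⟨hw, fun x y hxy => ?_⟩
    rw [← h, edgeCurvature_mk]
    exact hasCurvature_of_six_le_egirth hc hg hw hxy

theorem curvature_eq_edgeCurvature (hc : G.Connected) (hg : 6 ≤ G.egirth) {w : G.edgeSet → ℝ}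
    (hw : ∀ e, 0 < w e) {x y : V} (h : G.Adj x y) :
    curvature G w x y = edgeCurvature G w ⟨s(x, y), h⟩ := by
  rw [edgeCurvature_mk]
  exact (hasCurvature_of_six_le_egirth hc hg hw h).curvature_eq

theorem vertexMass_eq_sum_edges (w : G.edgeSet → ℝ) (v : V) :
    vertexMass G w v = ∑ e : G.edgeSet, if v ∈ (e : Sym2 V) then w e else 0 := by
  classical
  rw [vertexMass, ← Finset.sum_filter]
  have : ∑ y, edgeWeight G w v y = ∑ y with G.Adj v y, edgeWeight G w v y := by
    rw [Finset.sum_filter]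
    refine Finset.sum_congr rfl fun y _ => ?_
    split_ifs with h
    · rfl
    · exact edgeWeight_of_not_adj h
  rw [this]
  refine Finset.sum_bij (fun y hy => ⟨s(v, y), (Finset.mem_filter.1 hy).2⟩) ?_ ?_ ?_ ?_
  · intro y hy
    simp
  · intro y hy z hz h
    exact Sym2.congr_right.1 (Subtype.ext_iff.1 h)
  · rintro ⟨e, he⟩ h
    have hv : v ∈ e := (Finset.mem_filter.1 h).2
    obtain ⟨y, rfl⟩ := hv
    exact ⟨y, by simpa using he, rfl⟩
  · intro y hy
    exact edgeWeight_of_adj _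

theorem sum_edgeCurvature {w : G.edgeSet → ℝ} (h : ∀ v, vertexMass G w v ≠ 0) :
    ∑ e, edgeCurvature G w e = 2 * ((Fintype.card V : ℝ) - (Fintype.card G.edgeSet : ℝ)) := by
  have h1 : ∑ e : G.edgeSet, (w e * ∑ v, if v ∈ (e : Sym2 V) then 1 / vertexMass G w v else 0) =
      Fintype.card V := by
    simp_rw [Finset.mul_sum]
    rw [Finset.sum_comm]
    have : ∀ v, ∑ e : G.edgeSet, w e * (if v ∈ (e : Sym2 V) then 1 / vertexMass G w v else 0) =
        1 := by
      intro v
      refine Eq.trans ?_ (mul_one_div_cancel (h v))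
      generalize 1 / vertexMass G w v = r
      rw [vertexMass_eq_sum_edges, Finset.sum_mul]
      refine Finset.sum_congr rfl fun e _ => ?_
      split_ifs <;> simp
    rw [Finset.sum_congr rfl fun v _ => this v]
    simp
  unfold edgeCurvature
  rw [Finset.sum_sub_distrib, ← Finset.mul_sum, h1]
  simp
  ring

theorem vertexMass_smul (c : ℝ) (w : G.edgeSet → ℝ) (v : V) :
    vertexMass G (c • w) v = c * vertexMass G w v := by
  simp [vertexMass_eq_sum_edges, Finset.mul_sum]

theorem edgeCurvature_smul {c : ℝ} (hc : c ≠ 0) (w : G.edgeSet → ℝ) (e : G.edgeSet) :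
    edgeCurvature G (c • w) e = edgeCurvature G w e := by
  simp only [edgeCurvature, vertexMass_smul, Pi.smul_apply, smul_eq_mul]
  congr 2
  rw [Finset.mul_sum, Finset.mul_sum]
  refine Finset.sum_congr rfl fun v _ => ?_
  split_ifs
  · by_cases h : vertexMass G w v = 0
    · simp [h]
    · field_simp
  · simp

theorem continuousAt_edgeCurvature {w : G.edgeSet → ℝ} (h : ∀ v, vertexMass G w v ≠ 0)
    (e : G.edgeSet) : ContinuousAt (fun w' => edgeCurvature G w' e) w := by
  have hm : ∀ v, Continuous fun w' => vertexMass G w' v := by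
    intro v
    simp_rw [vertexMass_eq_sum_edges]
    refine continuous_finsetSum _ fun e _ => ?_
    split_ifs <;> fun_prop
  unfold edgeCurvature
  refine (continuousAt_const.mul ((continuous_apply e).continuousAt.mul ?_)).sub continuousAt_const
  refine tendsto_finsetSum _ fun v _ => ?_
  split_ifs
  · exact continuousAt_const.div (hm v).continuousAt (h v)
  · exact tendsto_const_nhds

omit [DecidableEq V] in
theorem vertexMass_pos_of_nonempty (hc : G.Connected) [he : Nonempty G.edgeSet]
    {w : G.edgeSet → ℝ} (hw : ∀ e, 0 < w e) (v : V) : 0 < vertexMass G w v := by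
  obtain ⟨e, he⟩ := he
  induction e using Sym2.ind with
  | _ x y =>
    have : Nontrivial V := ⟨x, y, (show G.Adj x y from he).ne⟩
    obtain ⟨u, hu⟩ := (G.degree_pos_iff_exists_adj v).1 (hc.preconnected.degree_pos_of_nontrivial v)
    exact vertexMass_pos hw hu

/-- Maximum principle: if the ratio `w' / w` is at most `R`, with equality at an edge where the
curvatures agree, then the vertex masses at both ends have ratio `R` as well. -/
theorem vertexMass_eq_of_ratio_max {w w' : G.edgeSet → ℝ} (hw : ∀ e, 0 < w e)
    (hw' : ∀ e, 0 < w' e) {R : ℝ} (hle : ∀ e, w' e ≤ R * w e) {x y : V}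
    (h : G.Adj x y) (heq : w' ⟨s(x, y), h⟩ = R * w ⟨s(x, y), h⟩)
    (hk : edgeCurvature G w' ⟨s(x, y), h⟩ = edgeCurvature G w ⟨s(x, y), h⟩) :
    vertexMass G w' x = R * vertexMass G w x := by
  have hmle : ∀ v, vertexMass G w' v ≤ R * vertexMass G w v := by
    intro v
    simp only [vertexMass_eq_sum_edges, Finset.mul_sum]
    refine Finset.sum_le_sum fun e _ => ?_
    split_ifs
    · exact hle e
    · simp
  rw [edgeCurvature_mk, edgeCurvature_mk, edgeWeight_of_adj h, edgeWeight_of_adj h, heq] at hk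
  have hmx := vertexMass_pos hw h
  have hmy := vertexMass_pos hw h.symm
  have hmx' := vertexMass_pos hw' h
  have hmy' := vertexMass_pos hw' h.symm
  have hwe := hw ⟨s(x, y), h⟩
  have hk' : R / vertexMass G w' x + R / vertexMass G w' y =
      1 / vertexMass G w x + 1 / vertexMass G w y := by
    refine mul_left_cancel₀ hwe.ne' ?_
    linear_combination hk / 2
  have key : ∀ v, 0 < vertexMass G w v → 0 < vertexMass G w' v →
      1 / vertexMass G w v ≤ R / vertexMass G w' v := by
    intro v h1 h2
    rw [div_le_div_iff₀ h1 h2]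
    linarith [hmle v]
  have hx := key x hmx hmx'
  have hy := key y hmy hmy'
  have : 1 / vertexMass G w x = R / vertexMass G w' x := by linarith
  rw [div_eq_div_iff hmx.ne' hmx'.ne'] at this
  linarith

/-- A positive weight is determined by its curvature up to scaling. -/
theorem exists_smul_of_edgeCurvature_eq (hc : G.Connected) {w w' : G.edgeSet → ℝ}
    (hw : ∀ e, 0 < w e) (hw' : ∀ e, 0 < w' e)
    (hk : ∀ e, edgeCurvature G w' e = edgeCurvature G w e) : ∃ c : ℝ, 0 < c ∧ w' = c • w := by
  cases isEmpty_or_nonempty G.edgeSet with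
  | inl he => exact ⟨1, one_pos, Subsingleton.elim _ _⟩
  | inr he =>
  obtain ⟨e₀, hmax⟩ := Finite.exists_max fun e => w' e / w e
  set R := w' e₀ / w e₀ with hRdef
  have hR : 0 < R := div_pos (hw' _) (hw _)
  have hle : ∀ e, w' e ≤ R * w e := fun e => (div_le_iff₀ (hw e)).1 (hmax e)
  have hstep : ∀ x, vertexMass G w' x = R * vertexMass G w x → ∀ y (h : G.Adj x y),
      w' ⟨s(x, y), h⟩ = R * w ⟨s(x, y), h⟩ := by
    intro x hx y h
    rw [vertexMass_eq_sum_edges, vertexMass_eq_sum_edges, Finset.mul_sum,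
      Finset.sum_eq_sum_iff_of_le] at hx
    · simpa using hx ⟨s(x, y), h⟩ (Finset.mem_univ _)
    · intro e _
      split_ifs
      · exact hle e
      · simp
  have hadj : ∀ x y, G.Adj x y → vertexMass G w' x = R * vertexMass G w x →
      vertexMass G w' y = R * vertexMass G w y := by
    intro x y h hx
    refine vertexMass_eq_of_ratio_max hw hw' hle h.symm ?_ (hk _)
    have := hstep x hx y h
    simpa only [Sym2.eq_swap] using this
  obtain ⟨x₀, hx₀⟩ : ∃ x, vertexMass G w' x = R * vertexMass G w x := by
    obtain ⟨e, he⟩ := e₀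
    induction e using Sym2.ind with
    | _ x y =>
      exact ⟨x, vertexMass_eq_of_ratio_max hw hw' hle he
        (div_mul_cancel₀ _ (hw _).ne').symm (hk _)⟩
  have hall : ∀ x, vertexMass G w' x = R * vertexMass G w x := by
    intro x
    obtain ⟨p⟩ := hc.preconnected x₀ x
    induction p with
    | nil => exact hx₀
    | cons h _ ih => exact ih (hadj _ _ h hx₀)
  refine ⟨R, hR, funext ?_⟩
  rintro ⟨e, he⟩
  induction e using Sym2.ind with
  | _ x y => exact hstep x (hall x) y he

namespace IsFlowSolution

variable {κ ω₀ : G.edgeSet → ℝ} {ω : ℝ → G.edgeSet → ℝ}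

theorem hasDerivAt_log (hω : IsFlowSolution G κ ω₀ ω) (hc : G.Connected) (hg : 6 ≤ G.egirth)
    {t : ℝ} (ht : 0 < t) (e : G.edgeSet) :
    HasDerivAt (fun s => Real.log (ω s e)) (κ e - edgeCurvature G (ω t) e) t := by
  obtain ⟨e, he⟩ := e
  induction e using Sym2.ind with
  | _ x y =>
    have hpos := hω.pos t ht.le ⟨s(x, y), he⟩
    have := (hω.flow t ht x y he).log hpos.ne'
    rw [curvature_eq_edgeCurvature hc hg (hω.pos t ht.le) he, mul_div_assoc,
      div_self hpos.ne'] at this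
    convert this using 1
    ring

/-- The product of the weights is a conserved quantity of the flow. -/
theorem prod_eq (hω : IsFlowSolution G κ ω₀ ω) (hc : G.Connected) (hg : 6 ≤ G.egirth)
    [Nonempty G.edgeSet]
    (hκ : ∑ e, κ e = 2 * ((Fintype.card V : ℝ) - (Fintype.card G.edgeSet : ℝ)))
    {s t : ℝ} (hs : 0 < s) (ht : 0 < t) : ∏ e, ω s e = ∏ e, ω t e := by
  have hd : ∀ t, 0 < t → HasDerivAt (fun s => ∑ e, Real.log (ω s e)) 0 t := by
    intro t ht
    have := HasDerivAt.fun_sum (u := Finset.univ) fun e _ => hω.hasDerivAt_log hc hg ht e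
    rwa [Finset.sum_sub_distrib, hκ, sum_edgeCurvature fun v =>
      (vertexMass_pos_of_nonempty hc (hω.pos t ht.le) v).ne', sub_self] at this
  have hconst : ∑ e, Real.log (ω s e) = ∑ e, Real.log (ω t e) :=
    isOpen_Ioi.is_const_of_deriv_eq_zero isPreconnected_Ioi
      (fun t ht => (hd t ht).differentiableAt.differentiableWithinAt)
      (fun t ht => (hd t ht).deriv) hs ht
  have hexp : ∀ t, 0 < t → ∏ e, ω t e = Real.exp (∑ e, Real.log (ω t e)) := by
    intro t ht
    rw [Real.exp_sum]
    exact Finset.prod_congr rfl fun e _ => (Real.exp_log (hω.pos t ht.le e)).symm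
  rw [hexp s hs, hexp t ht, hconst]

theorem limit_pos (hω : IsFlowSolution G κ ω₀ ω) (hc : G.Connected) (hg : 6 ≤ G.egirth)
    [Nonempty G.edgeSet]
    (hκ : ∑ e, κ e = 2 * ((Fintype.card V : ℝ) - (Fintype.card G.edgeSet : ℝ)))
    {ωlim : G.edgeSet → ℝ} (hlim : Tendsto ω atTop (𝓝 ωlim)) (e : G.edgeSet) : 0 < ωlim e := by
  rw [tendsto_pi_nhds] at hlim
  have hprod : ∏ e, ωlim e = ∏ e, ω 1 e := by
    refine tendsto_nhds_unique (tendsto_finsetProd _ fun e _ => hlim e)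
      (tendsto_const_nhds.congr' ?_)
    filter_upwards [eventually_gt_atTop 0] with t ht
    exact hω.prod_eq hc hg hκ one_pos ht
  have hne : ∏ e, ωlim e ≠ 0 := by
    rw [hprod]
    exact (Finset.prod_pos fun e _ => hω.pos 1 zero_le_one e).ne'
  refine lt_of_le_of_ne (ge_of_tendsto (hlim e) ?_)
    (Finset.prod_ne_zero_iff.1 hne e (Finset.mem_univ e)).symm
  filter_upwards [eventually_ge_atTop 0] with t ht
  exact (hω.pos t ht e).le

theorem edgeCurvature_limit (hω : IsFlowSolution G κ ω₀ ω) (hc : G.Connected)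
    (hg : 6 ≤ G.egirth) {ωlim : G.edgeSet → ℝ} (hlim : Tendsto ω atTop (𝓝 ωlim))
    (hpos : ∀ e, 0 < ωlim e) (e : G.edgeSet) : edgeCurvature G ωlim e = κ e := by
  have : Nonempty G.edgeSet := ⟨e⟩
  have h1 : Tendsto (fun t => Real.log (ω t e)) atTop (𝓝 (Real.log (ωlim e))) :=
    ((tendsto_pi_nhds.1 hlim) e).log (hpos e).ne'
  have h2 : Tendsto (fun t => κ e - edgeCurvature G (ω t) e) atTop
      (𝓝 (κ e - edgeCurvature G ωlim e)) :=
    tendsto_const_nhds.sub ((continuousAt_edgeCurvature (fun v =>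
      (vertexMass_pos_of_nonempty hc hpos v).ne') e).tendsto.comp hlim)
  have := eq_zero_of_tendsto_of_tendsto_deriv (fun t ht => hω.hasDerivAt_log hc hg ht e) h1 h2
  linarith

end IsFlowSolution

end PrescribedFlow

theorem theorem3 {V : Type*} [Fintype V] [DecidableEq V] (G : SimpleGraph V) [DecidableRel G.Adj]
    (hconn : G.Connected) (hgirth : 6 ≤ G.egirth)
    (κ : G.edgeSet → ℝ)
    (hκ : ∑ e, κ e = 2 * ((Fintype.card V : ℝ) - (Fintype.card G.edgeSet : ℝ)))
    (ω₀ : G.edgeSet → ℝ) (ω : ℝ → G.edgeSet → ℝ)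
    (hω : PrescribedFlow.IsFlowSolution G κ ω₀ ω)
    (ωlim : G.edgeSet → ℝ) (hlim : Filter.Tendsto ω Filter.atTop (nhds ωlim)) :
    PrescribedFlow.Attainable G κ ∧
      PrescribedFlow.IsWeightOf G κ ωlim ∧
      ∀ w : G.edgeSet → ℝ, PrescribedFlow.IsWeightOf G κ w ↔ ∃ c : ℝ, 0 < c ∧ w = c • ωlim := by
  have hpos : ∀ e, 0 < ωlim e := fun e =>
    have : Nonempty G.edgeSet := ⟨e⟩
    hω.limit_pos hconn hgirth hκ hlim e
  have hk := hω.edgeCurvature_limit hconn hgirth hlim hpos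
  have hmain : PrescribedFlow.IsWeightOf G κ ωlim :=
    (PrescribedFlow.isWeightOf_iff hconn hgirth).2 ⟨hpos, hk⟩
  refine ⟨⟨ωlim, hmain⟩, hmain, fun w => ⟨fun hw => ?_, ?_⟩⟩
  · obtain ⟨hw, hkw⟩ := (PrescribedFlow.isWeightOf_iff hconn hgirth).1 hw
    exact PrescribedFlow.exists_smul_of_edgeCurvature_eq hconn hpos hw fun e =>
      (hkw e).trans (hk e).symm
  · rintro ⟨c, hc, rfl⟩
    refine (PrescribedFlow.isWeightOf_iff hconn hgirth).2 ⟨fun e => mul_pos hc (hpos e), fun e => ?_⟩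
    rw [PrescribedFlow.edgeCurvature_smul hc.ne', hk]
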